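/- Let $\ell_1(\mathbb N)$ be the Banach space of absolutely summable complex sequences $(x_n)_{n\ge 0}$, with the convolution product $(x\cdot y)_n=\sum_{k=0}^n x_k y_{n-k}$, and let $\ell_1(\mathbb N)^d$ carry the product topology and the product algebra structure (operations taken in each of the $d$ components). For a sequence $w=(w_n)_{n\ge1}$ of positive real numbers let $B_w(x_0,x_1,x_2,\dots)=(w_1x_1,w_2x_2,\dots)$. Let $(w(a))_{a>0}$ be a family of weight sequences such that either $w_1(a)\cdots w_n(a)=n^a$ for all $a>0$ and $n\ge1$, or $w_n(a)=1+\frac an$ for all $a>0$ and $n\ge 1$. Then each $B_{w(a)}$, $a>0$, is a continuous linear operator on $\ell_1(\mathbb N)$, and for every integer $d\ge1$ the family $\big(B_{w(\lambda_1)}\times\cdots\times B_{w(\lambda_d)}\big)_{\lambda\in(0,+\infty)^d}$ admits a common hypercyclic algebra on $\ell_1(\mathbb N)^d$: there is a subalgebra $A\neq\{0\}$ (not required to contain the unit) of $\ell_1(\mathbb N)^d$ such that for every $x\in A\setminus\{0\}$ and every $\lambda\in(0,+\infty)^d$ the orbit $\{(B_{w(\lambda_1)}\times\cdots\times B_{w(\lambda_d)})^n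 x : n\ge1\}$ is dense in $\ell_1(\mathbb N)^d$. -/

import Mathlib

/-- The Banach space `ℓ₁(ℕ)` of absolutely summable complex sequences `(x₀, x₁, …)`. -/
abbrev EllOne : Type := lp (fun _ : ℕ => ℂ) 1

namespace EllOne

/-- The convolution (Cauchy) product of two complex sequences. -/
noncomputable def conv (x y : ℕ → ℂ) : ℕ → ℂ :=
  fun n => ∑ k ∈ Finset.range (n + 1), x k * y (n - k)

theorem memℓp_one_iff (x : ℕ → ℂ) : Memℓp x 1 ↔ Summable fun n => ‖x n‖ := by
  rw [memℓp_gen_iff (by simp)]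
  simp

theorem memℓp_conv {x y : ℕ → ℂ} (hx : Memℓp x 1) (hy : Memℓp y 1) :
    Memℓp (conv x y) 1 := by
  rw [memℓp_one_iff] at *
  exact summable_norm_sum_mul_range_of_summable_norm hx hy

noncomputable instance : Mul EllOne :=
  ⟨fun x y => ⟨conv x y, memℓp_conv x.2 y.2⟩⟩

noncomputable instance : One EllOne := ⟨lp.single 1 0 1⟩

theorem mul_apply (x y : EllOne) (n : ℕ) :
    (x * y) n = ∑ k ∈ Finset.range (n + 1), x k * y (n - k) := rfl

/-- The generating formal power series of an element of `ℓ₁(ℕ)`. It is only used to check the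
ring axioms. -/
noncomputable def toPowerSeries (x : EllOne) : PowerSeries ℂ := PowerSeries.mk fun n => x n

theorem toPowerSeries_injective : Function.Injective toPowerSeries := by
  intro x y h
  apply lp.ext
  funext n
  simpa [toPowerSeries] using congrArg (PowerSeries.coeff n) h

theorem toPowerSeries_add (x y : EllOne) :
    toPowerSeries (x + y) = toPowerSeries x + toPowerSeries y := by
  ext n
  simp [toPowerSeries]

theorem toPowerSeries_zero : toPowerSeries 0 = 0 := by
  ext n
  simp [toPowerSeries]

theorem toPowerSeries_smul (c : ℂ) (x : EllOne) :
    toPowerSeries (c • x) = c • toPowerSeries x := by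
  ext n
  simp [toPowerSeries]

theorem toPowerSeries_mul (x y : EllOne) :
    toPowerSeries (x * y) = toPowerSeries x * toPowerSeries y := by
  ext n
  rw [PowerSeries.coeff_mul, Finset.Nat.sum_antidiagonal_eq_sum_range_succ_mk]
  simp [toPowerSeries, mul_apply]

theorem toPowerSeries_one : toPowerSeries 1 = 1 := by
  ext n
  rw [PowerSeries.coeff_one]
  simp only [toPowerSeries, PowerSeries.coeff_mk]
  change (lp.single 1 0 (1 : ℂ) : EllOne) n = _
  rw [lp.single_apply]
  simp [Pi.single_apply]

/-- `ℓ₁(ℕ)` is a commutative ring for the convolution product. -/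
noncomputable instance : CommRing EllOne :=
  { (inferInstance : AddCommGroup EllOne) with
    mul := (· * ·)
    one := 1
    mul_assoc := fun x y z => toPowerSeries_injective <| by
      simp only [toPowerSeries_mul, mul_assoc]
    mul_comm := fun x y => toPowerSeries_injective <| by
      simp only [toPowerSeries_mul, mul_comm]
    one_mul := fun x => toPowerSeries_injective <| by
      simp only [toPowerSeries_mul, toPowerSeries_one, one_mul]
    mul_one := fun x => toPowerSeries_injective <| by
      simp only [toPowerSeries_mul, toPowerSeries_one, mul_one]
    zero_mul := fun x => toPowerSeries_injective <| by
      simp only [toPowerSeries_mul, toPowerSeries_zero, zero_mul]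
    mul_zero := fun x => toPowerSeries_injective <| by
      simp only [toPowerSeries_mul, toPowerSeries_zero, mul_zero]
    left_distrib := fun x y z => toPowerSeries_injective <| by
      simp only [toPowerSeries_mul, toPowerSeries_add, mul_add]
    right_distrib := fun x y z => toPowerSeries_injective <| by
      simp only [toPowerSeries_mul, toPowerSeries_add, add_mul] }

/-- `ℓ₁(ℕ)` with the convolution product is an algebra over `ℂ`, with its usual vector space
structure. -/
noncomputable instance : Algebra ℂ EllOne :=
  Algebra.ofModule
    (fun c x y => toPowerSeries_injective <| by
      simp only [toPowerSeries_mul, toPowerSeries_smul, smul_mul_assoc])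
    (fun c x y => toPowerSeries_injective <| by
      simp only [toPowerSeries_mul, toPowerSeries_smul, mul_smul_comm])

end EllOne

/-- The weighted backward shift `(x₀, x₁, x₂, …) ↦ (w₁ x₁, w₂ x₂, …)` on complex sequences. The
weight sequence is indexed by `n ≥ 1`; the value `w 0` plays no role. -/
noncomputable def weightedShift (w : ℕ → ℝ) (x : ℕ → ℂ) : ℕ → ℂ :=
  fun n => (w (n + 1) : ℂ) * x (n + 1)

/-- A weight sequence is admissible on `ℓ₁(ℕ)` when the weighted backward shift maps `ℓ₁(ℕ)` to
itself and is continuous. -/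
structure IsAdmissible (w : ℕ → ℝ) : Prop where
  mem : ∀ x : EllOne, Memℓp (weightedShift w x) 1
  cont : Continuous fun x : EllOne => (⟨weightedShift w x, mem x⟩ : EllOne)

/-- The weighted backward shift `B_w` as a continuous operator on `ℓ₁(ℕ)`. -/
noncomputable def backwardShift (w : ℕ → ℝ) (hw : IsAdmissible w) : EllOne →L[ℂ] EllOne where
  toFun x := ⟨weightedShift w x, hw.mem x⟩
  map_add' x y := by
    apply lp.ext
    funext n
    exact mul_add _ _ _
  map_smul' c x := by
    apply lp.ext
    funext n
    exact mul_left_comm _ _ _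
  cont := hw.cont

/-- `x` is a hypercyclic vector of `T`: the orbit `{Tⁿ x : n ≥ 1}` is dense. -/
def IsHypercyclicVector {X : Type*} [TopologicalSpace X] [AddCommGroup X] [Module ℂ X]
    (T : X →L[ℂ] X) (x : X) : Prop :=
  Dense {y : X | ∃ n : ℕ, 1 ≤ n ∧ y = T^[n] x}

/-- The family `(T i)` admits a common hypercyclic algebra: there is a (not necessarily unital)
subalgebra, different from `{0}`, all of whose non-zero elements are hypercyclic vectors of every
`T i`. -/
def HasCommonHypercyclicAlgebra {X ι : Type*} [TopologicalSpace X] [CommRing X] [Algebra ℂ X]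
    (T : ι → X →L[ℂ] X) : Prop :=
  ∃ A : NonUnitalSubalgebra ℂ X, A ≠ ⊥ ∧ ∀ x ∈ A, x ≠ 0 → ∀ i, IsHypercyclicVector (T i) x

/-- The operator `B_{w 0} × ⋯ × B_{w (d - 1)}` on `ℓ₁(ℕ)ᵈ`. -/
noncomputable def shiftProd {d : ℕ} (w : Fin d → ℕ → ℝ) (hw : ∀ i, IsAdmissible (w i)) :
    (Fin d → EllOne) →L[ℂ] (Fin d → EllOne) :=
  ContinuousLinearMap.pi fun i =>
    (backwardShift (w i) (hw i)).comp (ContinuousLinearMap.proj i)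

/-!
The algebra is `{P(u) : P ∈ ℂ[X], P(0) = 0}` for a generic `u ∈ ℓ₁(ℕ)ᵈ`, obtained from the Baire
category theorem. It suffices that for every degree `m = μ + 1`, every target `y` in a countable
dense set, every `δ` and every parameter box `K = [1 / (q + 1), q + 1]ᵈ`, the following holds on a
dense open set of vectors `u`: for all `λ ∈ K` some iterate `T_λⁿ` sends `u ^ m` close to `y` and
`u, …, u ^ (m - 1)` close to `0`. Indeed `T_λⁿ P(u)` is then close to `y` times the leading
coefficient of a polynomial `P` of degree `m` (`isHypercyclicVector_aeval`).

For the density, a finitely supported vector is perturbed to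
`U = u + ∑ⱼ fⱼ + ε X ^ σ` in each component, elements of finite support being regarded as
polynomials. Here `fⱼ` sits at position `Nⱼ = (j + 1) s`, for `t` indices `j`, and
`σ = 2 (t + 1) s`, so that all `fⱼ` live in the first half of `[0, σ]`. In
`U ^ m` only the terms `ε ^ m X ^ (m σ)` and `m ε ^ (m - 1) X ^ ((m - 1) σ) fⱼ` reach beyond degree
`(m - 1) σ` (`exists_pow_succ_eq`). At the time `nᵢ = (m - 1) σ + Nᵢ` the lower powers of `U` and
the blocks with `j < i` are therefore killed, the block `fᵢ` is sent to the target if the parameter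
is the `i`-th point of a grid in `K`, and the blocks with `j > i` are seen with the coefficient
`W_λ(nⱼ) / (W_λ(nⱼ - nᵢ) W_{λⱼ}(nⱼ))`, where `W_λ(n) = w₁(λ) ⋯ wₙ(λ)`.

All that is needed of the weights is that `W_λ(n)` behaves like a power of `n`, in the form of
`HasPolyGrowth`. Changing `λ` by `τ` multiplies `W_λ(n)` by at most a power of `n` with exponent of
order `τ`, so a grid with `t = g ^ d` points and mesh of order `1 / g` is fine enough as long as `n`
is polynomial in `g`. With `s = g ^ A` the ratios `nⱼ / (nⱼ - nᵢ)` are of order at most `g ^ d`,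
whatever `A` is, while `W_{λⱼ}(nⱼ)` is at least of order `g ^ (A γ)` for some `γ > 0`. Taking `A`
large makes the unwanted blocks and the perturbation itself small as `g → ∞`
(`eventually_exists_perturb`). Polynomially many grid points suffice for any `d`, so the dimension
of the parameter space is no obstruction.
-/

/-! ### The Banach algebra `ℓ₁(ℕ)` -/

namespace EllOne

open Polynomial

theorem norm_eq_tsum (x : EllOne) : ‖x‖ = ∑' n, ‖x n‖ := by
  rw [lp.norm_eq_tsum_rpow (by simp)]
  simp

theorem summable_norm (x : EllOne) : Summable fun n => ‖x n‖ :=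
  (memℓp_one_iff x).1 x.2

theorem norm_conv_le (x y : EllOne) : ‖x * y‖ ≤ ‖x‖ * ‖y‖ := by
  have hx : Summable fun n => ‖(‖x n‖ : ℝ)‖ := by simpa using summable_norm x
  have hy : Summable fun n => ‖(‖y n‖ : ℝ)‖ := by simpa using summable_norm y
  have h := (summable_norm_sum_mul_range_of_summable_norm hx hy).of_norm
  rw [norm_eq_tsum x, norm_eq_tsum y, tsum_mul_tsum_eq_tsum_sum_range_of_summable_norm hx hy,
    norm_eq_tsum]
  refine (summable_norm _).tsum_le_tsum (fun n => ?_) h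
  rw [mul_apply]
  refine (norm_sum_le _ _).trans (le_of_eq ?_)
  simp

instance : ContinuousMul EllOne := by
  let _ : NormedCommRing EllOne :=
    { (inferInstance : CommRing EllOne), (inferInstance : NormedAddCommGroup EllOne) with
      norm_mul_le := norm_conv_le }
  exact (inferInstance : ContinuousMul EllOne)

/-- A polynomial, viewed as the finitely supported sequence of its coefficients. -/
noncomputable def ofPoly (P : ℂ[X]) : EllOne :=
  ⟨P.coeff, (memℓp_one_iff _).2 <| summable_of_ne_finset_zero (s := P.support) (by simp)⟩

@[simp]
theorem ofPoly_apply (P : ℂ[X]) (n : ℕ) : ofPoly P n = P.coeff n := rfl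

theorem toPowerSeries_ofPoly (P : ℂ[X]) : toPowerSeries (ofPoly P) = (P : PowerSeries ℂ) := by
  ext n
  simp [toPowerSeries]

theorem ofPoly_add (P Q : ℂ[X]) : ofPoly (P + Q) = ofPoly P + ofPoly Q := by
  apply lp.ext
  funext n
  simp

theorem ofPoly_zero : ofPoly 0 = 0 := by
  apply lp.ext
  funext n
  simp

theorem ofPoly_sub (P Q : ℂ[X]) : ofPoly (P - Q) = ofPoly P - ofPoly Q := by
  apply lp.ext
  funext n
  simp

theorem ofPoly_mul (P Q : ℂ[X]) : ofPoly (P * Q) = ofPoly P * ofPoly Q := by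
  apply toPowerSeries_injective
  simp [toPowerSeries_mul, toPowerSeries_ofPoly]

theorem ofPoly_one : ofPoly 1 = 1 := by
  apply toPowerSeries_injective
  simp [toPowerSeries_one, toPowerSeries_ofPoly]

theorem ofPoly_pow (P : ℂ[X]) (n : ℕ) : ofPoly (P ^ n) = ofPoly P ^ n := by
  induction n with
  | zero => simp [ofPoly_one]
  | succ n ih => rw [pow_succ, pow_succ, ofPoly_mul, ih]

theorem ofPoly_sum {ι : Type*} (s : Finset ι) (P : ι → ℂ[X]) :
    ofPoly (∑ i ∈ s, P i) = ∑ i ∈ s, ofPoly (P i) := by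
  classical
  induction s using Finset.induction_on with
  | empty => simp [ofPoly_zero]
  | insert i s hi ih => rw [Finset.sum_insert hi, Finset.sum_insert hi, ofPoly_add, ih]

theorem ofPoly_monomial (j : ℕ) (c : ℂ) : ofPoly (monomial j c) = lp.single 1 j c := by
  apply lp.ext
  funext n
  rw [ofPoly_apply, coeff_monomial, lp.single_apply, Pi.single_apply]
  simp [eq_comm]

theorem norm_ofPoly_monomial (j : ℕ) (c : ℂ) : ‖ofPoly (monomial j c)‖ = ‖c‖ := by
  rw [ofPoly_monomial, lp.norm_single (by simp)]

theorem norm_ofPoly_sum_le {ι : Type*} (s : Finset ι) (e : ι → ℕ) (c : ι → ℂ) :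
    ‖ofPoly (∑ i ∈ s, monomial (e i) (c i))‖ ≤ ∑ i ∈ s, ‖c i‖ := by
  rw [ofPoly_sum]
  refine (norm_sum_le _ _).trans (le_of_eq ?_)
  simp [norm_ofPoly_monomial]

theorem denseRange_ofPoly : DenseRange ofPoly := by
  intro x
  have h := lp.hasSum_single (p := 1) (by simp) x
  refine mem_closure_of_tendsto h (Filter.Eventually.of_forall fun s => ?_)
  exact ⟨∑ i ∈ s, monomial i (x i), by simp [ofPoly_sum, ofPoly_monomial]⟩

instance : TopologicalSpace.SeparableSpace EllOne := by
  have h := (Set.countable_range fun n => (lp.single 1 n (1 : ℂ) : EllOne)).isSeparable.span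
    (R := ℂ)
  rw [← TopologicalSpace.isSeparable_univ_iff]
  refine h.closure.mono fun x _ => ?_
  refine closure_mono ?_ (denseRange_ofPoly x)
  rintro _ ⟨P, rfl⟩
  rw [P.as_sum_support, ofPoly_sum]
  refine Submodule.sum_mem _ fun i _ => ?_
  have : ofPoly (monomial i (P.coeff i)) = P.coeff i • (lp.single 1 i (1 : ℂ) : EllOne) := by
    rw [ofPoly_monomial, ← lp.single_smul, smul_eq_mul, mul_one]
  rw [this]
  exact Submodule.smul_mem _ _ (Submodule.subset_span ⟨i, rfl⟩)

end EllOne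

open EllOne Polynomial

/-! ### Iterates of weighted shifts -/

theorem norm_weightedShift_le {w : ℕ → ℝ} {C : ℝ} (h : ∀ n, 1 ≤ n → |w n| ≤ C) (x : ℕ → ℂ)
    (n : ℕ) :
    ‖weightedShift w x n‖ ≤ C * ‖x (n + 1)‖ := by
  rw [weightedShift, norm_mul, Complex.norm_real]
  exact mul_le_mul_of_nonneg_right (h _ (by omega)) (norm_nonneg _)

theorem memℓp_weightedShift {w : ℕ → ℝ} {C : ℝ} (h : ∀ n, 1 ≤ n → |w n| ≤ C) (x : EllOne) :
    Memℓp (weightedShift w x) 1 := by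
  rw [memℓp_one_iff]
  refine Summable.of_nonneg_of_le (fun n => norm_nonneg _) (norm_weightedShift_le h x) ?_
  exact ((summable_nat_add_iff 1).2 (summable_norm x)).mul_left C

theorem norm_mk_weightedShift_le {w : ℕ → ℝ} {C : ℝ} (h : ∀ n, 1 ≤ n → |w n| ≤ C) (x : EllOne)
    (hx : Memℓp (weightedShift w x) 1) :
    ‖(⟨weightedShift w x, hx⟩ : EllOne)‖ ≤ C * ‖x‖ := by
  have hC : 0 ≤ C := (abs_nonneg _).trans (h 1 le_rfl)
  have h1 : Summable fun n => ‖x (n + 1)‖ := (summable_nat_add_iff 1).2 (summable_norm x)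
  rw [norm_eq_tsum, norm_eq_tsum x, (summable_norm x).tsum_eq_zero_add]
  calc ∑' n, ‖weightedShift w x n‖ ≤ ∑' n, C * ‖x (n + 1)‖ :=
        Summable.tsum_le_tsum (norm_weightedShift_le h x)
          ((memℓp_one_iff _).1 hx) (h1.mul_left C)
    _ = C * ∑' n, ‖x (n + 1)‖ := tsum_mul_left
    _ ≤ _ := mul_le_mul_of_nonneg_left (le_add_of_nonneg_left (norm_nonneg _)) hC

theorem isAdmissible_of_bounded {w : ℕ → ℝ} {C : ℝ} (h : ∀ n, 1 ≤ n → |w n| ≤ C) :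
    IsAdmissible w := by
  refine ⟨memℓp_weightedShift h, ?_⟩
  let L : EllOne →ₗ[ℂ] EllOne :=
    { toFun := fun x => ⟨weightedShift w x, memℓp_weightedShift h x⟩
      map_add' := fun x y => lp.ext (funext fun n => mul_add _ _ _)
      map_smul' := fun c x => lp.ext (funext fun n => mul_left_comm _ _ _) }
  exact (L.mkContinuous C fun x => norm_mk_weightedShift_le h x _).continuous

theorem norm_backwardShift_iterate_le {w : ℕ → ℝ} (hw : IsAdmissible w) {C : ℝ}
    (h : ∀ n, 1 ≤ n → |w n| ≤ C) (n : ℕ) (x : EllOne) :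
    ‖(backwardShift w hw)^[n] x‖ ≤ C ^ n * ‖x‖ := by
  have hC : 0 ≤ C := (abs_nonneg _).trans (h 1 le_rfl)
  induction n with
  | zero => simp
  | succ n ih =>
    rw [Function.iterate_succ_apply', pow_succ', mul_assoc]
    exact (norm_mk_weightedShift_le h _ _).trans (mul_le_mul_of_nonneg_left ih hC)

/-- The product `w (l + 1) ⋯ w (l + n)` of `n` consecutive weights. -/
noncomputable def weightProd (w : ℕ → ℝ) (l n : ℕ) : ℝ := ∏ k ∈ Finset.range n, w (l + k + 1)

theorem backwardShift_iterate_apply {w : ℕ → ℝ} (hw : IsAdmissible w) (n : ℕ) (x : EllOne)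
    (l : ℕ) : ((backwardShift w hw)^[n] x) l = (weightProd w l n : ℂ) * x (l + n) := by
  induction n generalizing x with
  | zero => simp [weightProd]
  | succ n ih =>
    rw [Function.iterate_succ_apply, ih, weightProd, weightProd, Finset.prod_range_succ]
    change _ * ((w (l + n + 1) : ℂ) * x (l + n + 1)) = _
    push_cast
    rw [mul_assoc, add_assoc]

theorem backwardShift_iterate_ofPoly_eq_zero {w : ℕ → ℝ} (hw : IsAdmissible w) {n : ℕ} {P : ℂ[X]}
    (h : P.natDegree < n) : (backwardShift w hw)^[n] (ofPoly P) = 0 := by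
  apply lp.ext
  funext l
  rw [backwardShift_iterate_apply, ofPoly_apply, coeff_eq_zero_of_natDegree_lt (by omega)]
  simp

theorem backwardShift_iterate_monomial {w : ℕ → ℝ} (hw : IsAdmissible w) (n q : ℕ) (c : ℂ) :
    (backwardShift w hw)^[n] (ofPoly (monomial (q + n) c)) =
      ofPoly (monomial q (weightProd w q n * c)) := by
  apply lp.ext
  funext l
  rw [backwardShift_iterate_apply, ofPoly_apply, ofPoly_apply, coeff_monomial, coeff_monomial]
  by_cases h : q = l
  · simp [h]
  · simp [h]

theorem shiftProd_iterate_apply {d : ℕ} (w : Fin d → ℕ → ℝ) (hw : ∀ i, IsAdmissible (w i)) (n : ℕ)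
    (x : Fin d → EllOne) (i : Fin d) :
    ((shiftProd w hw)^[n] x) i = (backwardShift (w i) (hw i))^[n] (x i) := by
  induction n generalizing x with
  | zero => rfl
  | succ n ih => rw [Function.iterate_succ_apply, ih]; rfl

/-! ### Growth of the products of weights -/

/-- Quantitative form of `w 1 ⋯ w n ≈ n ^ a`: the weights at the parameter `a` are compared with
powers of `(n + 1) / n`, and so are the ratios of weights at two parameters. The lower bound starts
at `n = 2`, because `w 1 = 1` when `w 1 ⋯ w n = n ^ a`. -/
structure HasPolyGrowth (w : Set.Ioi (0 : ℝ) → ℕ → ℝ) : Prop where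
  one_le : ∀ a n, 1 ≤ n → 1 ≤ w a n
  le_exp : ∀ a n, 1 ≤ n → w a n ≤ Real.exp a
  lower : ∀ (a : Set.Ioi (0 : ℝ)) (n : ℕ) (γ : ℝ), 2 ≤ n → 0 ≤ γ → γ ≤ 1 → γ ≤ a →
    (((n : ℝ) + 1) / n) ^ γ ≤ w a n
  upper : ∀ (a : Set.Ioi (0 : ℝ)) (n : ℕ), 1 ≤ n → w a (n + 1) ≤ (((n : ℝ) + 1) / n) ^ (a : ℝ)
  ratio : ∀ (a b : Set.Ioi (0 : ℝ)) (n : ℕ), 1 ≤ n →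
    w a n ≤ (((n : ℝ) + 1) / n) ^ (2 * |(a : ℝ) - b|) * w b n

theorem succ_div_eq (n : ℕ) (hn : 1 ≤ n) : ((n : ℝ) + 1) / n = 1 + 1 / n := by
  have : (n : ℝ) ≠ 0 := by positivity
  field_simp

/-- `1 + 1 / n ≥ exp (1 / (n + 1))`, raised to a power. -/
theorem exp_le_succ_div_rpow (n : ℕ) (hn : 1 ≤ n) {a : ℝ} (ha : 0 ≤ a) :
    Real.exp (a / (n + 1)) ≤ (((n : ℝ) + 1) / n) ^ a := by
  have hn' : (0 : ℝ) < n := by exact_mod_cast hn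
  rw [Real.rpow_def_of_pos (by positivity), Real.exp_le_exp, div_eq_mul_inv, mul_comm]
  refine mul_le_mul_of_nonneg_right ?_ ha
  have h := Real.one_sub_inv_le_log_of_pos (x := ((n : ℝ) + 1) / n) (by positivity)
  refine le_trans (le_of_eq ?_) h
  field_simp
  ring

theorem succ_div_rpow_le_exp (n : ℕ) (hn : 1 ≤ n) {a : ℝ} (ha : 0 ≤ a) :
    (((n : ℝ) + 1) / n) ^ a ≤ Real.exp (a / n) := by
  have hn' : (0 : ℝ) < n := by exact_mod_cast hn
  rw [Real.rpow_def_of_pos (by positivity), Real.exp_le_exp, div_eq_mul_inv, mul_comm]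
  refine mul_le_mul_of_nonneg_left ?_ ha
  have h := Real.log_le_sub_one_of_pos (x := ((n : ℝ) + 1) / n) (by positivity)
  refine h.trans (le_of_eq ?_)
  field_simp
  ring

theorem hasPolyGrowth_of_prod_eq {w : Set.Ioi (0 : ℝ) → ℕ → ℝ}
    (hw : ∀ a : Set.Ioi (0 : ℝ), ∀ n : ℕ, 1 ≤ n →
      ∏ k ∈ Finset.Icc 1 n, w a k = (n : ℝ) ^ (a : ℝ)) : HasPolyGrowth w := by
  have h1 : ∀ a, w a 1 = 1 := fun a => by simpa using hw a 1 le_rfl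
  have h2 : ∀ (a : Set.Ioi (0 : ℝ)) (n : ℕ), 1 ≤ n →
      w a (n + 1) = (((n : ℝ) + 1) / n) ^ (a : ℝ) := by
    intro a n hn
    have hn' : (0 : ℝ) < n := by exact_mod_cast hn
    have h := hw a (n + 1) (by omega)
    rw [Finset.prod_Icc_succ_top (by omega), hw a n hn] at h
    have hpos : (0 : ℝ) < (n : ℝ) ^ (a : ℝ) := by positivity
    rw [Real.div_rpow (by positivity) hn'.le, eq_div_iff hpos.ne', mul_comm]
    exact_mod_cast h
  have hbase : ∀ n : ℕ, 1 ≤ n → (1 : ℝ) ≤ ((n : ℝ) + 1) / n := fun n hn => by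
    rw [succ_div_eq n hn]
    have : (0 : ℝ) ≤ 1 / n := by positivity
    linarith
  refine ⟨?_, ?_, ?_, fun a n hn => (h2 a n hn).le, ?_⟩
  · intro a n hn
    obtain rfl | ⟨k, hk, rfl⟩ : n = 1 ∨ ∃ k, 1 ≤ k ∧ n = k + 1 := by
      rcases eq_or_lt_of_le hn with h | h
      · exact Or.inl h.symm
      · exact Or.inr ⟨n - 1, by omega, by omega⟩
    · exact (h1 a).ge
    · rw [h2 a k hk]
      exact Real.one_le_rpow (hbase k hk) a.2.le
  · intro a n hn
    obtain rfl | ⟨k, hk, rfl⟩ : n = 1 ∨ ∃ k, 1 ≤ k ∧ n = k + 1 := by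
      rcases eq_or_lt_of_le hn with h | h
      · exact Or.inl h.symm
      · exact Or.inr ⟨n - 1, by omega, by omega⟩
    · rw [h1]
      exact Real.one_le_exp a.2.le
    · rw [h2 a k hk]
      refine (succ_div_rpow_le_exp k hk a.2.le).trans ?_
      rw [Real.exp_le_exp]
      exact div_le_self a.2.le (by exact_mod_cast hk)
  · intro a n γ hn h0 _ ha
    obtain ⟨k, hk, rfl⟩ : ∃ k, 1 ≤ k ∧ n = k + 1 := ⟨n - 1, by omega, by omega⟩
    rw [h2 a k hk]
    refine (Real.rpow_le_rpow (by positivity) ?_ h0).trans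
      (Real.rpow_le_rpow_of_exponent_le (hbase k hk) ha)
    rw [succ_div_eq _ (by omega), succ_div_eq _ hk]
    have hk' : (0 : ℝ) < k := by exact_mod_cast hk
    push_cast
    gcongr
    linarith
  · intro a b n hn
    have hc : (0 : ℝ) ≤ |(a : ℝ) - b| := abs_nonneg _
    obtain rfl | ⟨k, hk, rfl⟩ : n = 1 ∨ ∃ k, 1 ≤ k ∧ n = k + 1 := by
      rcases eq_or_lt_of_le hn with h | h
      · exact Or.inl h.symm
      · exact Or.inr ⟨n - 1, by omega, by omega⟩
    · rw [h1, h1, mul_one]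
      exact Real.one_le_rpow (hbase 1 le_rfl) (by positivity)
    · have hk' : (1 : ℝ) ≤ k := by exact_mod_cast hk
      have hkpos : (0 : ℝ) < k := by linarith
      rw [h2 a k hk, h2 b k hk]
      calc (((k : ℝ) + 1) / k) ^ (a : ℝ)
          ≤ (((k : ℝ) + 1) / k) ^ (|(a : ℝ) - b| + b) :=
            Real.rpow_le_rpow_of_exponent_le (hbase k hk) (by linarith [le_abs_self ((a : ℝ) - b)])
        _ = (((k : ℝ) + 1) / k) ^ (|(a : ℝ) - b|) * (((k : ℝ) + 1) / k) ^ (b : ℝ) :=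
            Real.rpow_add (by positivity) _ _
        _ ≤ _ := by
            gcongr
            rw [Real.rpow_mul (by positivity), Real.rpow_two]
            refine Real.rpow_le_rpow (by positivity) ?_ hc
            push_cast
            rw [div_pow, div_le_div_iff₀ hkpos (by positivity)]
            nlinarith [mul_nonneg hkpos.le hkpos.le]

theorem hasPolyGrowth_of_eq {w : Set.Ioi (0 : ℝ) → ℕ → ℝ}
    (hw : ∀ a : Set.Ioi (0 : ℝ), ∀ n : ℕ, 1 ≤ n → w a n = 1 + (a : ℝ) / (n : ℝ)) :
    HasPolyGrowth w := by
  have hpos : ∀ a : Set.Ioi (0 : ℝ), (0 : ℝ) < a := fun a => a.2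
  refine ⟨?_, ?_, ?_, ?_, ?_⟩
  · intro a n hn
    have := hpos a
    rw [hw a n hn]
    have : (0 : ℝ) ≤ (a : ℝ) / n := by positivity
    linarith
  · intro a n hn
    rw [hw a n hn]
    have h1 : (a : ℝ) / n ≤ a := div_le_self (hpos a).le (by exact_mod_cast hn)
    linarith [Real.add_one_le_exp (a : ℝ)]
  · intro a n γ hn h0 h1 ha
    have hn' : (0 : ℝ) < n := by positivity
    rw [hw a n (by omega), succ_div_eq n (by omega)]
    have hs : (-1 : ℝ) ≤ 1 / n := by
      have : (0 : ℝ) ≤ 1 / n := by positivity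
      linarith
    refine (rpow_one_add_le_one_add_mul_self hs h0 h1).trans ?_
    rw [mul_one_div]
    gcongr
  · intro a n hn
    rw [hw a (n + 1) (by omega)]
    refine le_trans ?_ (exp_le_succ_div_rpow n hn (hpos a).le)
    push_cast
    linarith [Real.add_one_le_exp ((a : ℝ) / (n + 1))]
  · intro a b n hn
    have hn' : (1 : ℝ) ≤ n := by exact_mod_cast hn
    have hn0 : (0 : ℝ) < n := by linarith
    have ha := hpos a
    have hb := hpos b
    have hc : (0 : ℝ) ≤ |(a : ℝ) - b| := abs_nonneg _
    rw [hw a n hn, hw b n hn]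
    have h1 : 1 + |(a : ℝ) - b| / n ≤ (((n : ℝ) + 1) / n) ^ (2 * |(a : ℝ) - b|) := by
      refine le_trans ?_ (exp_le_succ_div_rpow n hn (by positivity))
      refine le_trans ?_ (Real.add_one_le_exp _)
      rw [add_comm]
      gcongr ?_ + 1
      rw [div_le_div_iff₀ hn0 (by positivity)]
      nlinarith
    calc 1 + (a : ℝ) / n ≤ 1 + (|(a : ℝ) - b| + b) / n := by
          gcongr
          linarith [le_abs_self ((a : ℝ) - b)]
      _ ≤ (1 + |(a : ℝ) - b| / n) * (1 + (b : ℝ) / n) := by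
          have : 0 ≤ |(a : ℝ) - b| / n * ((b : ℝ) / n) := by positivity
          rw [add_div]
          nlinarith
      _ ≤ _ := by gcongr

namespace HasPolyGrowth

variable {w : Set.Ioi (0 : ℝ) → ℕ → ℝ}

theorem abs_le_exp (hw : HasPolyGrowth w) (a : Set.Ioi (0 : ℝ)) (n : ℕ) (hn : 1 ≤ n) :
    |w a n| ≤ Real.exp a := by
  rw [abs_of_nonneg (zero_le_one.trans (hw.one_le a n hn))]
  exact hw.le_exp a n hn

theorem isAdmissible (hw : HasPolyGrowth w) (a : Set.Ioi (0 : ℝ)) : IsAdmissible (w a) :=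
  isAdmissible_of_bounded (hw.abs_le_exp a)

theorem weightProd_pos (hw : HasPolyGrowth w) (a : Set.Ioi (0 : ℝ)) (l n : ℕ) :
    0 < weightProd (w a) l n :=
  Finset.prod_pos fun k _ => zero_lt_one.trans_le (hw.one_le a _ (by omega))

theorem weightProd_succ (v : ℕ → ℝ) (l n : ℕ) :
    weightProd v l (n + 1) = weightProd v l n * v (l + n + 1) :=
  Finset.prod_range_succ _ _

theorem weightProd_le (hw : HasPolyGrowth w) (a : Set.Ioi (0 : ℝ)) {q : ℕ} (hq : 1 ≤ q) (n : ℕ) :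
    weightProd (w a) q n ≤ (((q : ℝ) + n) / q) ^ (a : ℝ) := by
  have hq' : (0 : ℝ) < q := by exact_mod_cast hq
  induction n with
  | zero => simp [weightProd, hq'.ne']
  | succ n ih =>
    rw [weightProd_succ]
    have h := hw.upper a (q + n) (by omega)
    calc weightProd (w a) q n * w a (q + n + 1)
        ≤ (((q : ℝ) + n) / q) ^ (a : ℝ) * ((((q + n : ℕ) : ℝ) + 1) / (q + n : ℕ)) ^ (a : ℝ) :=
          mul_le_mul ih h (zero_le_one.trans (hw.one_le a _ (by omega))) (by positivity)
      _ = _ := by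
          rw [← Real.mul_rpow (by positivity) (by positivity)]
          congr 1
          push_cast
          field_simp
          ring

theorem le_weightProd (hw : HasPolyGrowth w) (a : Set.Ioi (0 : ℝ)) {γ : ℝ} (h0 : 0 ≤ γ)
    (h1 : γ ≤ 1) (ha : γ ≤ a) (l : ℕ) {n : ℕ} (hn : 1 ≤ n) :
    ((n : ℝ) / (l + 2)) ^ γ ≤ weightProd (w a) l n := by
  -- the first factor `w (l + 1)` is only bounded below by `1`, since `l` may be `0`
  have key : (((l : ℝ) + 1 + n) / (l + 2)) ^ γ ≤ weightProd (w a) l n := by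
    induction n, hn using Nat.le_induction with
    | base =>
      have : ((l : ℝ) + 1 + (1 : ℕ)) / (l + 2) = 1 := by
        rw [div_eq_one_iff_eq (by positivity)]
        push_cast
        ring
      rw [this, Real.one_rpow]
      simpa [weightProd] using hw.one_le a (l + 1) (by omega)
    | succ n hn ih =>
      rw [weightProd_succ]
      have h := hw.lower a (l + n + 1) γ (by omega) h0 h1 ha
      calc (((l : ℝ) + 1 + (n + 1 : ℕ)) / (l + 2)) ^ γ
          = (((l : ℝ) + 1 + n) / (l + 2)) ^ γ *
              ((((l + n + 1 : ℕ) : ℝ) + 1) / (l + n + 1 : ℕ)) ^ γ := by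
            rw [← Real.mul_rpow (by positivity) (by positivity)]
            congr 1
            push_cast
            field_simp
            ring
        _ ≤ _ := mul_le_mul ih h (by positivity) (hw.weightProd_pos a l n).le
  refine le_trans (Real.rpow_le_rpow (by positivity) ?_ h0) key
  gcongr
  linarith [(Nat.cast_nonneg l : (0 : ℝ) ≤ l)]

theorem weightProd_le_mul (hw : HasPolyGrowth w) (a b : Set.Ioi (0 : ℝ)) (l n : ℕ) :
    weightProd (w a) l n ≤ ((l : ℝ) + n + 1) ^ (2 * |(a : ℝ) - b|) * weightProd (w b) l n := by
  have key : weightProd (w a) l n ≤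
      (((l : ℝ) + n + 1) / (l + 1)) ^ (2 * |(a : ℝ) - b|) * weightProd (w b) l n := by
    induction n with
    | zero =>
      have : ((l : ℝ) + (0 : ℕ) + 1) / (l + 1) = 1 := by
        rw [div_eq_one_iff_eq (by positivity)]
        push_cast
        ring
      rw [this]
      simp [weightProd]
    | succ n ih =>
      rw [weightProd_succ, weightProd_succ]
      have h := hw.ratio a b (l + n + 1) (by omega)
      have hpos := hw.weightProd_pos b l n
      refine (mul_le_mul ih h (zero_le_one.trans (hw.one_le a _ (by omega)))
        (by positivity)).trans (le_of_eq ?_)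
      have : (((l : ℝ) + (n + 1 : ℕ) + 1) / (l + 1)) =
          (((l : ℝ) + n + 1) / (l + 1)) * ((((l + n + 1 : ℕ) : ℝ) + 1) / (l + n + 1 : ℕ)) := by
        push_cast
        field_simp
        ring
      rw [this, Real.mul_rpow (by positivity) (by positivity)]
      ring
  refine key.trans ?_
  have hpos := (hw.weightProd_pos b l n).le
  gcongr
  exact div_le_self (by positivity) (by linarith [(Nat.cast_nonneg l : (0 : ℝ) ≤ l)])

end HasPolyGrowth

/-! ### The perturbation in one component -/

/-- If `G` has degree at most `σ / 2`, then up to degree-`μ σ` terms the power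
`(G + ε X ^ σ) ^ (μ + 1)` consists only of its two top binomial terms. -/
theorem exists_pow_succ_eq (G : ℂ[X]) {σ : ℕ} (ε : ℂ) (h : 2 * G.natDegree ≤ σ) (μ : ℕ) :
    ∃ R : ℂ[X], R.natDegree ≤ μ * σ ∧ (G + monomial σ ε) ^ (μ + 1) =
      monomial ((μ + 1) * σ) (ε ^ (μ + 1)) + monomial (μ * σ) ((μ + 1) * ε ^ μ) * G + R := by
  induction μ with
  | zero => exact ⟨0, by simp, by simp [add_comm]⟩
  | succ μ ih =>
    obtain ⟨R, hR, hU⟩ := ih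
    refine ⟨monomial (μ * σ) ((μ + 1) * ε ^ μ) * G * G + R * (G + monomial σ ε), ?_, ?_⟩
    · have hmon : ∀ (k : ℕ) (c : ℂ), (monomial k c).natDegree ≤ k := fun k c =>
        natDegree_monomial_le c
      refine natDegree_add_le_of_degree_le ?_ ?_
      · refine (natDegree_mul_le.trans (add_le_add natDegree_mul_le le_rfl)).trans ?_
        have := hmon (μ * σ) ((μ + 1) * ε ^ μ)
        rw [show (μ + 1) * σ = μ * σ + σ by ring]
        omega
      · refine natDegree_mul_le.trans ?_
        have : (G + monomial σ ε).natDegree ≤ σ :=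
          natDegree_add_le_of_degree_le (by omega) (hmon _ _)
        rw [show (μ + 1) * σ = μ * σ + σ by ring]
        omega
    · have e1 : monomial ((μ + 1) * σ) (ε ^ (μ + 1)) * monomial σ ε =
          monomial ((μ + 1 + 1) * σ) (ε ^ (μ + 1 + 1)) := by
        rw [monomial_mul_monomial, ← pow_succ]
        congr 2
        ring
      have e2 : monomial (μ * σ) ((μ + 1) * ε ^ μ) * monomial σ ε =
          monomial ((μ + 1) * σ) ((μ + 1) * ε ^ (μ + 1)) := by
        rw [monomial_mul_monomial, show μ * σ + σ = (μ + 1) * σ by ring,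
          show ((μ : ℂ) + 1) * ε ^ μ * ε = (μ + 1) * ε ^ (μ + 1) by ring]
      have e3 : monomial ((μ + 1) * σ) ((((μ + 1 : ℕ) : ℂ) + 1) * ε ^ (μ + 1)) =
          monomial ((μ + 1) * σ) (((μ : ℂ) + 1) * ε ^ (μ + 1)) +
            monomial ((μ + 1) * σ) (ε ^ (μ + 1)) := by
        rw [← map_add]
        congr 1
        push_cast
        ring
      rw [pow_succ, hU, e3, ← e1, ← e2]
      ring

/-- The times at which the orbit of the vector `perturb` visits the target: `t` times, separated
by `s`, in the first half of a window of length `2 (t + 1) s`. -/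
def hitTime (μ t s j : ℕ) : ℕ := μ * (2 * (t + 1) * s) + (j + 1) * s

section Block

variable (w : Set.Ioi (0 : ℝ) → ℕ → ℝ) (v : ℂ[X]) (μ t s : ℕ) (ε : ℝ)
  (a : Fin t → Set.Ioi (0 : ℝ))

/-- The sum over `j` of copies of `v` at position `(j + 1) s`, with coefficients divided so that
multiplying by the coefficient `(μ + 1) ε ^ μ` and applying the shift of parameter `a j` for
`hitTime μ t s j` steps gives back `v`. -/
noncomputable def blocks : ℂ[X] :=
  ∑ x ∈ (Finset.univ : Finset (Fin t)) ×ˢ v.support, monomial (((x.1 : ℕ) + 1) * s + x.2)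
    (v.coeff x.2 / ((μ + 1) * ε ^ μ * weightProd (w (a x.1)) x.2 (hitTime μ t s x.1)))

/-- The perturbation of `u` all of whose shifts by `hitTime μ t s j` send the power `μ + 1` close
to `v` and kill the lower powers. -/
noncomputable def perturb (u : ℂ[X]) : ℂ[X] :=
  u + blocks w v μ t s ε a + monomial (2 * (t + 1) * s) (ε : ℂ)

variable {w v μ t s ε a}

theorem natDegree_add_blocks_le {u : ℂ[X]} (hu : u.natDegree < s) (hv : v.natDegree < s) :
    (u + blocks w v μ t s ε a).natDegree ≤ (t + 1) * s := by
  have h1 : s ≤ (t + 1) * s := Nat.le_mul_of_pos_left _ (by omega)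
  refine natDegree_add_le_of_degree_le (by omega) ?_
  refine natDegree_sum_le_of_forall_le _ _ fun x hx => (natDegree_monomial_le _).trans ?_
  have hl : x.2 ≤ v.natDegree := le_natDegree_of_mem_supp _ (Finset.mem_product.1 hx).2
  have hj : ((x.1 : ℕ) + 1) * s ≤ t * s := Nat.mul_le_mul_right _ x.1.2
  rw [show (t + 1) * s = t * s + s by ring]
  omega

theorem natDegree_perturb_le {u : ℂ[X]} (hu : u.natDegree < s) (hv : v.natDegree < s) :
    (perturb w v μ t s ε a u).natDegree ≤ 2 * (t + 1) * s := by
  refine natDegree_add_le_of_degree_le ((natDegree_add_blocks_le hu hv).trans ?_)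
    (natDegree_monomial_le _)
  rw [mul_assoc]
  omega

theorem norm_perturb_sub_le (hw : HasPolyGrowth w) (hε : 0 < ε) {L : ℝ} (hL : 0 < L)
    (hP : ∀ j : Fin t, ∀ l ≤ v.natDegree, L ≤ weightProd (w (a j)) l (hitTime μ t s j))
    (u : ℂ[X]) :
    ‖ofPoly (perturb w v μ t s ε a u) - ofPoly u‖ ≤
      ε + t * (∑ l ∈ v.support, ‖v.coeff l‖) / ((μ + 1) * ε ^ μ * L) := by
  have h1 : ofPoly (perturb w v μ t s ε a u) - ofPoly u =
      ofPoly (monomial (2 * (t + 1) * s) (ε : ℂ)) + ofPoly (blocks w v μ t s ε a) := by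
    rw [perturb, ofPoly_add, ofPoly_add]
    abel
  rw [h1]
  refine (norm_add_le _ _).trans (add_le_add (le_of_eq ?_) ?_)
  · rw [norm_ofPoly_monomial, Complex.norm_real, Real.norm_of_nonneg hε.le]
  · refine (norm_ofPoly_sum_le _ _ _).trans ?_
    have h2 : ∀ x ∈ (Finset.univ : Finset (Fin t)) ×ˢ v.support,
        ‖v.coeff x.2 / ((μ + 1) * ε ^ μ * weightProd (w (a x.1)) x.2 (hitTime μ t s x.1))‖ ≤
          ‖v.coeff x.2‖ / ((μ + 1) * ε ^ μ * L) := by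
      intro x hx
      have hl : x.2 ≤ v.natDegree := le_natDegree_of_mem_supp _ (Finset.mem_product.1 hx).2
      have hp := hw.weightProd_pos (a x.1) x.2 (hitTime μ t s x.1)
      have h3 : ‖((μ : ℂ) + 1) * (ε : ℂ) ^ μ *
          (weightProd (w (a x.1)) x.2 (hitTime μ t s x.1) : ℂ)‖ =
          (μ + 1) * ε ^ μ * weightProd (w (a x.1)) x.2 (hitTime μ t s x.1) := by
        have : ((μ : ℂ) + 1) * (ε : ℂ) ^ μ *
          (weightProd (w (a x.1)) x.2 (hitTime μ t s x.1) : ℂ) =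
          (((μ + 1) * ε ^ μ * weightProd (w (a x.1)) x.2 (hitTime μ t s x.1) : ℝ) : ℂ) := by
          push_cast
          ring
        rw [this, Complex.norm_real, Real.norm_of_nonneg (by positivity)]
      rw [norm_div, h3]
      gcongr
      exact hP x.1 x.2 hl
    refine (Finset.sum_le_sum h2).trans (le_of_eq ?_)
    rw [Finset.sum_product]
    simp [Finset.sum_div, mul_div_assoc]

/-- The shift of parameter `b` at time `hitTime μ t s i` sends the `j`-th block close to `v` for
`j = i`, kills it for `j < i`, and makes it small for `j > i`. -/
theorem norm_shift_block_sub_le (hw : HasPolyGrowth w) (hadm : ∀ b, IsAdmissible (w b))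
    (hv : v.natDegree < s) {β L : ℝ} (hL : 0 < L)
    (hP : ∀ j : Fin t, ∀ l ≤ v.natDegree, L ≤ weightProd (w (a j)) l (hitTime μ t s j))
    (i j : Fin t) (b : Set.Ioi (0 : ℝ)) (hb : (b : ℝ) ≤ β) {l : ℕ} (hl : l ∈ v.support) :
    ‖(backwardShift (w b) (hadm b))^[hitTime μ t s i] (ofPoly (monomial (hitTime μ t s j + l)
        (v.coeff l / weightProd (w (a j)) l (hitTime μ t s j)))) -
        if j = i then ofPoly (monomial l (v.coeff l)) else 0‖ ≤
      ‖v.coeff l‖ * ((if j = i then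
        (2 * (μ + 1) * (t + 1) * s : ℝ) ^ (2 * |(b : ℝ) - a i|) - 1 else 0) +
        (2 * (μ + 1) * (t + 1)) ^ β / L) := by
  have hlv : l ≤ v.natDegree := le_natDegree_of_mem_supp _ hl
  have hs : 0 < s := by omega
  have hs' : (0 : ℝ) < s := by exact_mod_cast hs
  have hβ : 0 < β := lt_of_lt_of_le b.2 hb
  have hK : 0 ≤ (2 * ((μ : ℝ) + 1) * (t + 1)) ^ β / L := by positivity
  have htop : ∀ j : Fin t, hitTime μ t s j + l + 1 ≤ 2 * (μ + 1) * (t + 1) * s := by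
    intro j
    have hj : ((j : ℕ) + 1) * s ≤ t * s := Nat.mul_le_mul_right _ j.2
    have e : 2 * (μ + 1) * (t + 1) * s = μ * (2 * (t + 1) * s) + t * s + s + (t + 1) * s := by
      ring
    rw [hitTime, e]
    omega
  have htop' : ∀ j : Fin t, ((hitTime μ t s j : ℝ) + l + 1) ≤ 2 * (μ + 1) * (t + 1) * s := by
    intro j
    exact_mod_cast htop j
  rcases lt_trichotomy j i with hji | rfl | hji
  · rw [if_neg hji.ne, if_neg hji.ne, backwardShift_iterate_ofPoly_eq_zero]
    · simpa using by positivity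
    · refine (natDegree_monomial_le _).trans_lt ?_
      have : ((j : ℕ) + 1 + 1) * s ≤ ((i : ℕ) + 1) * s :=
        Nat.mul_le_mul_right _ (by have : (j : ℕ) < i := hji; omega)
      rw [add_mul, one_mul] at this
      rw [hitTime, hitTime]
      omega
  · rw [if_pos rfl, if_pos rfl, add_comm (hitTime μ t s j) l, backwardShift_iterate_monomial,
      ← ofPoly_sub, ← map_sub, norm_ofPoly_monomial]
    have hp := hw.weightProd_pos (a j) l (hitTime μ t s j)
    have hq := hw.weightProd_pos b l (hitTime μ t s j)
    have hab := hw.weightProd_le_mul b (a j) l (hitTime μ t s j)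
    have hba := hw.weightProd_le_mul (a j) b l (hitTime μ t s j)
    rw [abs_sub_comm] at hba
    have hQ : ((l : ℝ) + hitTime μ t s j + 1) ^ (2 * |(b : ℝ) - a j|) ≤
        (2 * (μ + 1) * (t + 1) * s : ℝ) ^ (2 * |(b : ℝ) - a j|) :=
      Real.rpow_le_rpow (by positivity) (by linarith [htop' j]) (by positivity)
    set Q := (2 * (μ + 1) * (t + 1) * s : ℝ) ^ (2 * |(b : ℝ) - a j|)
    set p := weightProd (w (a j)) l (hitTime μ t s j)
    set q := weightProd (w b) l (hitTime μ t s j)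
    have e : (q : ℂ) * (v.coeff l / p) - v.coeff l = v.coeff l * ((q / p - 1 : ℝ) : ℂ) := by
      push_cast
      ring
    rw [e, norm_mul, Complex.norm_real, Real.norm_eq_abs]
    refine mul_le_mul_of_nonneg_left (le_trans ?_ (le_add_of_nonneg_right hK)) (norm_nonneg _)
    have h1 : q / p ≤ Q := by
      rw [div_le_iff₀ hp]
      exact hab.trans (by gcongr)
    have h2 : 1 ≤ Q * (q / p) := by
      rw [← mul_div_assoc, le_div_iff₀ hp, one_mul]
      exact hba.trans (by gcongr)
    have h0 : 0 < q / p := by positivity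
    rw [abs_le]
    constructor
    · nlinarith
    · linarith
  · rw [if_neg hji.ne', if_neg hji.ne', sub_zero, zero_add]
    have hij : ((i : ℕ) + 1) * s + s ≤ ((j : ℕ) + 1) * s := by
      rw [← Nat.succ_mul]
      exact Nat.mul_le_mul_right _ (by have : (i : ℕ) < j := hji; omega)
    obtain ⟨q, hq⟩ : ∃ q, hitTime μ t s j + l = q + hitTime μ t s i :=
      ⟨hitTime μ t s j + l - hitTime μ t s i, by unfold hitTime; omega⟩
    have hqs : s ≤ q := by
      unfold hitTime at hq
      omega
    rw [hq, backwardShift_iterate_monomial, norm_ofPoly_monomial]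
    have hp := hw.weightProd_pos (a j) l (hitTime μ t s j)
    have hq0 := hw.weightProd_pos b q (hitTime μ t s i)
    have hqR : (s : ℝ) ≤ q := by exact_mod_cast hqs
    have hle : weightProd (w b) q (hitTime μ t s i) ≤ (2 * (μ + 1) * (t + 1)) ^ β := by
      refine (hw.weightProd_le b (by omega) _).trans ?_
      have hbase : ((q : ℝ) + hitTime μ t s i) / q ≤ 2 * (μ + 1) * (t + 1) := by
        have e : (q : ℝ) + hitTime μ t s i = hitTime μ t s j + l := by exact_mod_cast hq.symm
        rw [e, div_le_iff₀ (hs'.trans_le hqR)]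
        calc ((hitTime μ t s j : ℝ) + l) ≤ 2 * (μ + 1) * (t + 1) * s := by linarith [htop' j]
          _ ≤ _ := by gcongr
      refine (Real.rpow_le_rpow (by positivity) hbase b.2.le).trans ?_
      refine Real.rpow_le_rpow_of_exponent_le ?_ hb
      nlinarith [(Nat.cast_nonneg μ : (0 : ℝ) ≤ μ), (Nat.cast_nonneg t : (0 : ℝ) ≤ t)]
    rw [norm_mul, norm_div, Complex.norm_real, Complex.norm_real, Real.norm_of_nonneg hq0.le,
      Real.norm_of_nonneg hp.le, mul_div_left_comm]
    refine mul_le_mul_of_nonneg_left ?_ (norm_nonneg _)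
    exact div_le_div₀ (by positivity) hle hL (hP j l hlv)

theorem natDegree_lt_hitTime (j : ℕ) {k : ℕ} (hs : 0 < s) (hk : k ≤ μ * (2 * (t + 1) * s)) :
    k < hitTime μ t s j := by
  have : 0 < (j + 1) * s := by positivity
  unfold hitTime
  omega

theorem shift_perturb_pow_eq_zero (hadm : ∀ b, IsAdmissible (w b)) {u : ℂ[X]}
    (hu : u.natDegree < s) (hv : v.natDegree < s) (b : Set.Ioi (0 : ℝ)) (i : ℕ) {k : ℕ}
    (hk : k ≤ μ) : (backwardShift (w b) (hadm b))^[hitTime μ t s i]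
      (ofPoly (perturb w v μ t s ε a u) ^ k) = 0 := by
  rw [← ofPoly_pow]
  refine backwardShift_iterate_ofPoly_eq_zero _ (natDegree_lt_hitTime _ (by omega) ?_)
  exact natDegree_pow_le.trans (Nat.mul_le_mul hk (natDegree_perturb_le hu hv))

/-- The error at time `hitTime μ t s i` comes from the top term `ε ^ (μ + 1) X ^ ((μ + 1) σ)`, from
the distance of the parameter `b` to `a i`, and from the blocks that have not been reached yet. -/
theorem norm_shift_perturb_pow_sub_le (hw : HasPolyGrowth w) (hadm : ∀ b, IsAdmissible (w b))
    (hε : 0 < ε) {u : ℂ[X]} (hu : u.natDegree < s) (hv : v.natDegree < s) {β L : ℝ} (hL : 0 < L)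
    (hP : ∀ j : Fin t, ∀ l ≤ v.natDegree, L ≤ weightProd (w (a j)) l (hitTime μ t s j))
    (i : Fin t) (b : Set.Ioi (0 : ℝ)) (hb : (b : ℝ) ≤ β) :
    ‖(backwardShift (w b) (hadm b))^[hitTime μ t s i]
        (ofPoly (perturb w v μ t s ε a u) ^ (μ + 1)) - ofPoly v‖ ≤
      ε ^ (μ + 1) * (2 * (μ + 1)) ^ β + (∑ l ∈ v.support, ‖v.coeff l‖) *
        ((2 * (μ + 1) * (t + 1) * s : ℝ) ^ (2 * |(b : ℝ) - a i|) - 1 +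
          t * ((2 * (μ + 1) * (t + 1)) ^ β / L)) := by
  have hs : 0 < s := by omega
  have hs' : (0 : ℝ) < s := by exact_mod_cast hs
  set σ := 2 * (t + 1) * s with hσ
  set n := hitTime μ t s i with hn
  obtain ⟨R, hR, hpow⟩ := exists_pow_succ_eq (u + blocks w v μ t s ε a) (σ := σ) (ε : ℂ)
    (by
      have := natDegree_add_blocks_le (w := w) (μ := μ) (ε := ε) (a := a) hu hv
      rw [hσ, mul_assoc]
      omega) μ
  -- the terms of low degree are killed by the shift
  have hR0 : (backwardShift (w b) (hadm b))^[n] (ofPoly R) = 0 :=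
    backwardShift_iterate_ofPoly_eq_zero _ (natDegree_lt_hitTime _ hs hR)
  have hu0 : (backwardShift (w b) (hadm b))^[n]
      (ofPoly (monomial (μ * σ) (((μ : ℂ) + 1) * (ε : ℂ) ^ μ) * u)) = 0 := by
    refine backwardShift_iterate_ofPoly_eq_zero _ ?_
    have h1 := natDegree_monomial_le (((μ : ℂ) + 1) * (ε : ℂ) ^ μ) (m := μ * σ)
    have h2 : s ≤ ((i : ℕ) + 1) * s := Nat.le_mul_of_pos_left _ (by omega)
    refine natDegree_mul_le.trans_lt ?_
    rw [hn, hitTime, ← hσ]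
    omega
  have hblocks : monomial (μ * σ) (((μ : ℂ) + 1) * (ε : ℂ) ^ μ) * blocks w v μ t s ε a =
      ∑ j : Fin t, ∑ l ∈ v.support, monomial (hitTime μ t s j + l)
        (v.coeff l / weightProd (w (a j)) l (hitTime μ t s j)) := by
    rw [blocks, Finset.mul_sum, Finset.sum_product]
    refine Finset.sum_congr rfl fun j _ => Finset.sum_congr rfl fun l _ => ?_
    rw [monomial_mul_monomial]
    have hp : (weightProd (w (a j)) l (hitTime μ t s j) : ℂ) ≠ 0 := by
      exact_mod_cast (hw.weightProd_pos (a j) l (hitTime μ t s j)).ne'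
    have hε' : (ε : ℂ) ≠ 0 := by exact_mod_cast hε.ne'
    have hμ : (μ : ℂ) + 1 ≠ 0 := by exact_mod_cast Nat.succ_ne_zero μ
    have hc : ((μ : ℂ) + 1) * (ε : ℂ) ^ μ * (v.coeff l /
        (((μ : ℂ) + 1) * (ε : ℂ) ^ μ * weightProd (w (a j)) l (hitTime μ t s j))) =
        v.coeff l / weightProd (w (a j)) l (hitTime μ t s j) := by
      field_simp
    rw [hc, ← add_assoc]
    rfl
  -- the term `ε ^ (μ + 1) X ^ ((μ + 1) σ)` is shifted to a position beyond `σ / 2`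
  have htop : ‖(backwardShift (w b) (hadm b))^[n]
      (ofPoly (monomial ((μ + 1) * σ) ((ε : ℂ) ^ (μ + 1))))‖ ≤
        ε ^ (μ + 1) * (2 * (μ + 1)) ^ β := by
    have hi : ((i : ℕ) + 1) * s ≤ t * s := Nat.mul_le_mul_right _ i.2
    have e1 : (μ + 1) * σ = μ * σ + (t * s + s + (t * s + s)) := by
      rw [hσ]
      ring
    obtain ⟨q, hq⟩ : ∃ q, (μ + 1) * σ = q + n :=
      ⟨(μ + 1) * σ - n, by rw [e1, hn, hitTime, ← hσ]; omega⟩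
    have hqs : t * s + s ≤ q := by
      rw [e1, hn, hitTime, ← hσ] at hq
      omega
    have hq1 : 1 ≤ q := by omega
    have hqR : (t : ℝ) * s + s ≤ q := by exact_mod_cast hqs
    rw [hq, backwardShift_iterate_monomial, norm_ofPoly_monomial, norm_mul, norm_pow,
      Complex.norm_real, Complex.norm_real, Real.norm_of_nonneg hε.le,
      Real.norm_of_nonneg (hw.weightProd_pos b q n).le, mul_comm]
    refine mul_le_mul_of_nonneg_left ((hw.weightProd_le b hq1 n).trans ?_) (by positivity)
    have hbase : ((q : ℝ) + n) / q ≤ 2 * (μ + 1) := by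
      have e2 : (q : ℝ) + n = (μ + 1) * (2 * (t + 1) * s) := by
        rw [hσ] at hq
        exact_mod_cast hq.symm
      have hq0 : (0 : ℝ) < q := by exact_mod_cast hq1
      rw [e2, div_le_iff₀ hq0]
      have h3 := mul_le_mul_of_nonneg_left hqR (by positivity : (0 : ℝ) ≤ 2 * (μ + 1))
      linarith
    refine (Real.rpow_le_rpow (by positivity) hbase b.2.le).trans ?_
    refine Real.rpow_le_rpow_of_exponent_le ?_ hb
    linarith [(Nat.cast_nonneg μ : (0 : ℝ) ≤ μ)]
  set Q := (2 * (μ + 1) * (t + 1) * s : ℝ) ^ (2 * |(b : ℝ) - a i|)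
  set K := (2 * ((μ : ℝ) + 1) * (t + 1)) ^ β / L
  have hv_sum : ofPoly v = ∑ j : Fin t, ∑ l ∈ v.support,
      if j = i then ofPoly (monomial l (v.coeff l)) else 0 := by
    conv_lhs => rw [v.as_sum_support, ofPoly_sum]
    rw [Finset.sum_comm]
    simp
  have hsplit : (backwardShift (w b) (hadm b))^[n]
        (ofPoly (perturb w v μ t s ε a u) ^ (μ + 1)) - ofPoly v =
      (backwardShift (w b) (hadm b))^[n] (ofPoly (monomial ((μ + 1) * σ) ((ε : ℂ) ^ (μ + 1)))) +
      ∑ j : Fin t, ∑ l ∈ v.support, ((backwardShift (w b) (hadm b))^[n]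
        (ofPoly (monomial (hitTime μ t s j + l)
          (v.coeff l / weightProd (w (a j)) l (hitTime μ t s j)))) -
        if j = i then ofPoly (monomial l (v.coeff l)) else 0) := by
    simp only [Finset.sum_sub_distrib]
    rw [← hv_sum, ← ofPoly_pow, perturb, hpow, mul_add, hblocks]
    simp only [ofPoly_add, ← FunLike.coe_pow_eq_iterate, map_add, ofPoly_sum, map_sum] at hR0 hu0 ⊢
    rw [hR0, hu0]
    abel
  rw [hsplit]
  refine (norm_add_le _ _).trans (add_le_add htop ?_)
  calc _ ≤ ∑ j : Fin t, ∑ l ∈ v.support,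
        ‖v.coeff l‖ * ((if j = i then Q - 1 else 0) + K) :=
        (norm_sum_le _ _).trans (Finset.sum_le_sum fun j _ => (norm_sum_le _ _).trans
          (Finset.sum_le_sum fun l hl =>
            norm_shift_block_sub_le hw hadm hv hL hP i j b hb hl))
    _ = _ := by
        simp only [← Finset.sum_mul]
        rw [← Finset.mul_sum, Finset.sum_add_distrib]
        simp

end Block

open Filter Topology

/-! ### Choice of the parameters of the perturbation -/

theorem tendsto_const_mul_natCast_rpow {e : ℝ} (he : e < 0) (C : ℝ) :
    Tendsto (fun g : ℕ => C * (g : ℝ) ^ e) atTop (𝓝 0) := by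
  have h := (tendsto_rpow_neg_atTop (neg_pos.2 he)).comp (tendsto_natCast_atTop_atTop (R := ℝ))
  simpa [Function.comp_def] using h.const_mul C

/-- A polynomial in `g`, raised to a power of order `1 / g`, tends to `1`. This is what makes a
grid with mesh of order `1 / g` fine enough. -/
theorem tendsto_mul_pow_rpow_div {C : ℝ} (hC : 0 < C) (E : ℕ) (β : ℝ) :
    Tendsto (fun g : ℕ => (C * (g : ℝ) ^ E) ^ (β / g)) atTop (𝓝 1) := by
  have h1 : Tendsto (fun g : ℕ => C ^ (β / (g : ℝ))) atTop (𝓝 1) := by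
    have := (Real.continuous_const_rpow hC.ne').tendsto 0 |>.comp
      (tendsto_const_div_atTop_nhds_zero_nat β)
    simpa [Function.comp_def] using this
  have h2 : Tendsto (fun g : ℕ => ((g : ℝ) ^ (β / (g : ℝ))) ^ E) atTop (𝓝 1) := by
    have := (tendsto_rpow_div_mul_add β 1 0 one_ne_zero.symm).comp
      (tendsto_natCast_atTop_atTop (R := ℝ))
    simpa [Function.comp_def] using this.pow E
  have h3 := h1.mul h2
  rw [mul_one] at h3
  refine h3.congr fun g => ?_
  have hg : (0 : ℝ) ≤ g := Nat.cast_nonneg g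
  rw [Real.mul_rpow hC.le (by positivity), ← Real.rpow_natCast (_ ^ _), ← Real.rpow_natCast _ E,
    ← Real.rpow_mul hg, ← Real.rpow_mul hg, mul_comm (E : ℝ)]

/-- In one component, with `g ^ d` hitting times separated by `g ^ A`, every polynomial `u` has a
perturbation that works for all parameters within `β / g` of prescribed parameters `a i`, as soon
as `g` is large. The condition on `A` makes the gap between hitting times outweigh their number. -/
theorem eventually_exists_perturb {w : Set.Ioi (0 : ℝ) → ℕ → ℝ} (hw : HasPolyGrowth w)
    (hadm : ∀ b, IsAdmissible (w b)) (d A μ : ℕ) {β γ : ℝ} (hβ : 0 < β) (hγ0 : 0 < γ)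
    (hγ1 : γ ≤ 1) (hA : d + d * β < A * γ) (u v : ℂ[X]) {δ : ℝ} (hδ : 0 < δ) :
    ∀ᶠ g : ℕ in atTop, ∀ a : Fin (g ^ d) → Set.Ioi (0 : ℝ), (∀ j, γ ≤ a j) →
      ∃ U : ℂ[X], ‖ofPoly U - ofPoly u‖ < δ ∧ ∀ (i : Fin (g ^ d)) (b : Set.Ioi (0 : ℝ)),
        (b : ℝ) ≤ β → |(b : ℝ) - a i| ≤ β / g →
          ‖(backwardShift (w b) (hadm b))^[hitTime μ (g ^ d) (g ^ A) i] (ofPoly U ^ (μ + 1)) -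
              ofPoly v‖ < δ ∧
          ∀ k ≤ μ, (backwardShift (w b) (hadm b))^[hitTime μ (g ^ d) (g ^ A) i]
            (ofPoly U ^ k) = 0 := by
  have hA0 : A ≠ 0 := by
    rintro rfl
    have : (0 : ℝ) ≤ d + d * β := by positivity
    simp at hA
    linarith
  set V := ∑ l ∈ v.support, ‖v.coeff l‖ with hV
  have hV0 : 0 ≤ V := Finset.sum_nonneg fun _ _ => norm_nonneg _
  set M : ℝ := (μ : ℝ) + 1 with hM
  have hM1 : 1 ≤ M := by
    rw [hM]
    linarith [(Nat.cast_nonneg μ : (0 : ℝ) ≤ μ)]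
  have hM0 : 0 < M := by linarith
  obtain ⟨ε, ⟨hε1, hε2⟩, hε0⟩ : ∃ ε : ℝ,
      (ε < δ / 2 ∧ ε ^ (μ + 1) * (2 * M) ^ β < δ / 2) ∧ 0 < ε := by
    have h1 : Tendsto (fun ε : ℝ => ε) (𝓝[>] 0) (𝓝 0) :=
      tendsto_nhdsWithin_of_tendsto_nhds tendsto_id
    have h2 : Tendsto (fun ε : ℝ => ε ^ (μ + 1) * (2 * M) ^ β) (𝓝[>] 0) (𝓝 0) := by
      simpa using (h1.pow (μ + 1)).mul_const ((2 * M) ^ β)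
    exact (((h1.eventually_lt_const (half_pos hδ)).and
      (h2.eventually_lt_const (half_pos hδ))).and self_mem_nhdsWithin).exists
  set c : ℝ := ((v.natDegree : ℝ) + 2) ^ γ with hc
  have hc0 : 0 < c := by positivity
  have t1 := tendsto_const_mul_natCast_rpow
    (e := d - A * γ) (by nlinarith [mul_nonneg (Nat.cast_nonneg d : (0 : ℝ) ≤ d) hβ.le])
    (V * c / (M * ε ^ μ))
  have t2 : Tendsto (fun g : ℕ => V * ((4 * M * (g : ℝ) ^ (d + A)) ^ ((2 * β) / g) - 1) +
      V * (4 * M) ^ β * c * (g : ℝ) ^ (d + d * β - A * γ)) atTop (𝓝 0) := by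
    have h1 := ((tendsto_mul_pow_rpow_div (C := 4 * M) (by positivity) (d + A) (2 * β)).sub_const
      1).const_mul V
    have h2 := tendsto_const_mul_natCast_rpow (e := d + d * β - A * γ) (by linarith)
      (V * (4 * M) ^ β * c)
    simpa using h1.add h2
  filter_upwards [t1.eventually_lt_const (half_pos hδ), t2.eventually_lt_const (half_pos hδ),
    eventually_gt_atTop u.natDegree, eventually_gt_atTop v.natDegree] with g ht1 ht2 hgu hgv a ha
  have hg : 1 ≤ g := by omega
  have hgR : (1 : ℝ) ≤ g := by exact_mod_cast hg
  have hg0 : (0 : ℝ) < g := by linarith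
  have hgA : g ≤ g ^ A := Nat.le_self_pow hA0 g
  have hgd : (1 : ℝ) ≤ (g : ℝ) ^ d := one_le_pow₀ hgR
  set L : ℝ := (g : ℝ) ^ (A * γ) / c with hL
  have hL0 : 0 < L := by positivity
  have hP : ∀ j : Fin (g ^ d), ∀ l ≤ v.natDegree,
      L ≤ weightProd (w (a j)) l (hitTime μ (g ^ d) (g ^ A) j) := by
    intro j l hl
    have hn : g ^ A ≤ hitTime μ (g ^ d) (g ^ A) j :=
      (Nat.le_mul_of_pos_left _ (by omega)).trans (Nat.le_add_left _ _)
    have hn' : (g : ℝ) ^ A ≤ hitTime μ (g ^ d) (g ^ A) j := by exact_mod_cast hn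
    refine le_trans ?_ (hw.le_weightProd (a j) hγ0.le hγ1 (ha j) l (by omega))
    rw [hL, hc, Real.rpow_mul hg0.le, Real.rpow_natCast, ← Real.div_rpow (by positivity)
      (by positivity)]
    have hl' : (l : ℝ) ≤ v.natDegree := by exact_mod_cast hl
    gcongr
  refine ⟨perturb w v μ (g ^ d) (g ^ A) ε a u, ?_, fun i b hb hbi => ⟨?_, fun k hk => ?_⟩⟩
  · refine (norm_perturb_sub_le hw hε0 hL0 hP u).trans_lt ?_
    have e : ((g ^ d : ℕ) : ℝ) * V / ((μ + 1) * ε ^ μ * L) =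
        V * c / (M * ε ^ μ) * (g : ℝ) ^ ((d : ℝ) - A * γ) := by
      rw [Real.rpow_sub hg0, Real.rpow_natCast, hL, ← hM]
      push_cast
      field_simp
    rw [e]
    linarith
  · refine (norm_shift_perturb_pow_sub_le hw hadm hε0 (hgu.trans_le hgA) (hgv.trans_le hgA) hL0 hP
      i b hb).trans_lt ?_
    have h1 : (2 * ((μ : ℝ) + 1) * ((g ^ d : ℕ) + 1) * (g ^ A : ℕ)) ^ (2 * |(b : ℝ) - a i|) ≤
        (4 * M * (g : ℝ) ^ (d + A)) ^ ((2 * β) / g) := by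
      have hbase : 2 * ((μ : ℝ) + 1) * ((g ^ d : ℕ) + 1) * (g ^ A : ℕ) ≤
          4 * M * (g : ℝ) ^ (d + A) := by
        rw [pow_add]
        push_cast
        calc 2 * ((μ : ℝ) + 1) * ((g : ℝ) ^ d + 1) * (g : ℝ) ^ A
            ≤ 2 * ((μ : ℝ) + 1) * ((g : ℝ) ^ d + (g : ℝ) ^ d) * (g : ℝ) ^ A := by gcongr
          _ = _ := by ring
      refine (Real.rpow_le_rpow (by positivity) hbase (by positivity)).trans ?_
      refine Real.rpow_le_rpow_of_exponent_le ?_ ?_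
      · have : (1 : ℝ) ≤ (g : ℝ) ^ (d + A) := one_le_pow₀ hgR
        nlinarith
      · rw [mul_div_assoc]
        linarith
    have h2 : ((g ^ d : ℕ) : ℝ) * ((2 * ((μ : ℝ) + 1) * ((g ^ d : ℕ) + 1)) ^ β / L) ≤
        (4 * M) ^ β * c * (g : ℝ) ^ (d + d * β - A * γ) := by
      have hbase : 2 * ((μ : ℝ) + 1) * ((g ^ d : ℕ) + 1) ≤ 4 * M * (g : ℝ) ^ d := by
        push_cast
        nlinarith
      have h3 : (2 * ((μ : ℝ) + 1) * ((g ^ d : ℕ) + 1)) ^ β ≤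
          (4 * M) ^ β * (g : ℝ) ^ (d * β) := by
        rw [Real.rpow_mul hg0.le, Real.rpow_natCast, ← Real.mul_rpow (by positivity)
          (by positivity)]
        exact Real.rpow_le_rpow (by positivity) hbase hβ.le
      calc _ ≤ ((g ^ d : ℕ) : ℝ) * ((4 * M) ^ β * (g : ℝ) ^ (d * β) / L) := by gcongr
        _ = _ := by
          rw [Real.rpow_sub hg0, Real.rpow_add hg0, Real.rpow_natCast, hL]
          push_cast
          field_simp
    have h3 := mul_le_mul_of_nonneg_left (add_le_add (sub_le_sub_right h1 1) h2) hV0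
    rw [mul_add V _ ((4 * M) ^ β * c * _), ← mul_assoc V, ← mul_assoc V] at h3
    linarith
  · exact shift_perturb_pow_eq_zero hadm (hgu.trans_le hgA) (hgv.trans_le hgA) b i hk

/-! ### Genericity and the hypercyclic algebra -/

/-- The vectors `u` such that, for every operator `T i` with `i ∈ S`, some iterate sends the power
`u ^ (μ + 1)` to within `δ` of `y` while sending the powers `u, …, u ^ μ` to within `δ` of `0`. -/
def goodVectors {X ι : Type*} [SeminormedAddCommGroup X] [Monoid X] (T : ι → X → X) (S : Set ι)
    (μ : ℕ) (y : X) (δ : ℝ) : Set X :=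
  {u | ∀ i ∈ S, ∃ n, 1 ≤ n ∧ ‖(T i)^[n] (u ^ (μ + 1)) - y‖ < δ ∧
    ∀ k, 1 ≤ k → k ≤ μ → ‖(T i)^[n] (u ^ k)‖ < δ}

/-- The polynomials in `u` without constant term. -/
noncomputable def polyAlgebra {X : Type*} [CommRing X] [Algebra ℂ X] (u : X) :
    NonUnitalSubalgebra ℂ X where
  carrier := {x | ∃ P : ℂ[X], P.coeff 0 = 0 ∧ aeval u P = x}
  add_mem' := by
    rintro _ _ ⟨P, hP, rfl⟩ ⟨Q, hQ, rfl⟩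
    exact ⟨P + Q, by simp [hP, hQ], map_add _ _ _⟩
  zero_mem' := ⟨0, by simp, map_zero _⟩
  mul_mem' := by
    rintro _ _ ⟨P, hP, rfl⟩ ⟨Q, hQ, rfl⟩
    exact ⟨P * Q, by simp [mul_coeff_zero, hP], map_mul _ _ _⟩
  smul_mem' := by
    rintro c _ ⟨P, hP, rfl⟩
    exact ⟨c • P, by simp [hP], map_smul _ _ _⟩

theorem norm_shiftProd_iterate_le {w : Set.Ioi (0 : ℝ) → ℕ → ℝ} (hw : HasPolyGrowth w)
    (hadm : ∀ b, IsAdmissible (w b)) {d : ℕ} {β : ℝ} (l : Fin d → Set.Ioi (0 : ℝ))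
    (hl : ∀ c, (l c : ℝ) ≤ β) (n : ℕ) (x : Fin d → EllOne) :
    ‖(shiftProd (fun i => w (l i)) (fun i => hadm (l i)))^[n] x‖ ≤ Real.exp β ^ n * ‖x‖ := by
  rw [pi_norm_le_iff_of_nonneg (by positivity)]
  intro c
  rw [shiftProd_iterate_apply]
  refine (norm_backwardShift_iterate_le (hadm (l c)) (C := Real.exp β) (fun k hk => ?_) n
    (x c)).trans ?_
  · exact (hw.abs_le_exp (l c) k hk).trans (Real.exp_le_exp.2 (hl c))
  · exact mul_le_mul_of_nonneg_left (norm_le_pi_norm x c) (by positivity)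

/-- On a bounded set of parameters the iterates up to time `N` are equicontinuous, so the
approximation property persists near `u`. -/
theorem mem_interior_goodVectors {w : Set.Ioi (0 : ℝ) → ℕ → ℝ} (hw : HasPolyGrowth w)
    (hadm : ∀ b, IsAdmissible (w b)) {d : ℕ} {β : ℝ} (hβ : 0 ≤ β)
    {S : Set (Fin d → Set.Ioi (0 : ℝ))} (hS : ∀ l ∈ S, ∀ c, (l c : ℝ) ≤ β) {μ N : ℕ}
    {y u : Fin d → EllOne} {δ : ℝ} (hδ : 0 < δ)
    (hu : ∀ l ∈ S, ∃ n, 1 ≤ n ∧ n ≤ N ∧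
      ‖(shiftProd (fun i => w (l i)) (fun i => hadm (l i)))^[n] (u ^ (μ + 1)) - y‖ < δ / 2 ∧
      ∀ k ≤ μ, (shiftProd (fun i => w (l i)) (fun i => hadm (l i)))^[n] (u ^ k) = 0) :
    u ∈ interior (goodVectors (fun (l : Fin d → Set.Ioi (0 : ℝ)) =>
      shiftProd (fun i => w (l i)) (fun i => hadm (l i))) S μ y δ) := by
  rw [mem_interior_iff_mem_nhds]
  set η := δ / 2 / Real.exp β ^ N with hη
  have hη0 : 0 < η := by positivity
  have hcont : ∀ᶠ u' in 𝓝 u, ∀ k ∈ Finset.range (μ + 2), ‖u' ^ k - u ^ k‖ < η := by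
    rw [Filter.eventually_all_finset]
    intro k _
    have h : Tendsto (fun u' : Fin d → EllOne => u' ^ k) (𝓝 u) (𝓝 (u ^ k)) :=
      (continuous_pow k).tendsto u
    have h' := Metric.tendsto_nhds.1 h η hη0
    simpa only [dist_eq_norm] using h'
  filter_upwards [hcont] with u' hu' l hl
  obtain ⟨n, hn1, hnN, hy, hk⟩ := hu l hl
  have hclose : ∀ k ≤ μ + 1,
      ‖(shiftProd (fun i => w (l i)) (fun i => hadm (l i)))^[n] (u' ^ k) -
        (shiftProd (fun i => w (l i)) (fun i => hadm (l i)))^[n] (u ^ k)‖ < δ / 2 := by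
    intro k hk
    rw [← iterate_map_sub]
    refine (norm_shiftProd_iterate_le hw hadm l (hS l hl) n _).trans_lt ?_
    have h1 := hu' k (Finset.mem_range.2 (by omega))
    calc Real.exp β ^ n * ‖u' ^ k - u ^ k‖ ≤ Real.exp β ^ N * ‖u' ^ k - u ^ k‖ := by
          gcongr
          exact Real.one_le_exp hβ
      _ < Real.exp β ^ N * η := by gcongr
      _ = δ / 2 := by rw [hη]; field_simp
  refine ⟨n, hn1, ?_, fun k _ hkμ => ?_⟩
  · refine (norm_sub_le_norm_sub_add_norm_sub _
      ((shiftProd (fun i => w (l i)) (fun i => hadm (l i)))^[n] (u ^ (μ + 1))) _).trans_lt ?_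
    linarith [hclose (μ + 1) le_rfl]
  · have h := hclose k (by omega)
    rw [hk k hkμ, sub_zero] at h
    exact h.trans (by linarith)

theorem exists_grid_index {γ β b : ℝ} (hβ : 0 < β) (hγ : 0 < γ) (h1 : γ ≤ b) (h2 : b ≤ β) {g : ℕ}
    (hg : 0 < g) : ∃ j : Fin g, |b - (γ + β * j / g)| ≤ β / g := by
  have hg' : (0 : ℝ) < g := by exact_mod_cast hg
  have hx0 : 0 ≤ (b - γ) * g / β := by
    have : 0 ≤ b - γ := by linarith
    positivity
  have hxg : (b - γ) * g / β < g := by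
    rw [div_lt_iff₀ hβ]
    nlinarith
  refine ⟨⟨⌊(b - γ) * g / β⌋₊, (Nat.floor_lt hx0).2 hxg⟩, ?_⟩
  have f1 := Nat.floor_le hx0
  have f2 := (Nat.lt_floor_add_one ((b - γ) * g / β)).le
  have e : b - γ = β / g * ((b - γ) * g / β) := by field_simp
  have hβg : 0 < β / g := by positivity
  have e2 : b - (γ + β * (⌊(b - γ) * g / β⌋₊ : ℝ) / g) =
      β / g * ((b - γ) * g / β - ⌊(b - γ) * g / β⌋₊) := by
    rw [mul_sub, ← e]
    ring
  rw [e2, abs_mul, abs_of_pos hβg]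
  refine mul_le_of_le_one_right hβg.le ?_
  rw [abs_le]
  constructor <;> linarith

/-- The key density statement: a vector with polynomial components is perturbed, in each component,
along one common sequence of hitting times, indexed by the points of a grid in the parameter box
`[1 / (q + 1), q + 1] ^ d`. -/
theorem dense_interior_goodVectors {w : Set.Ioi (0 : ℝ) → ℕ → ℝ} (hw : HasPolyGrowth w)
    (hadm : ∀ b, IsAdmissible (w b)) (d q μ : ℕ) (y : Fin d → EllOne) {δ : ℝ} (hδ : 0 < δ) :
    Dense (interior (goodVectors (fun (l : Fin d → Set.Ioi (0 : ℝ)) =>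
      shiftProd (fun i => w (l i)) (fun i => hadm (l i)))
      {l | ∀ c, 1 / ((q : ℝ) + 1) ≤ l c ∧ (l c : ℝ) ≤ q + 1} μ y δ)) := by
  rw [Metric.dense_iff]
  intro x r hr
  set β : ℝ := (q : ℝ) + 1 with hβ
  set γ : ℝ := 1 / β with hγ
  have hβ1 : 1 ≤ β := by
    rw [hβ]
    linarith [(Nat.cast_nonneg q : (0 : ℝ) ≤ q)]
  have hβ0 : 0 < β := by linarith
  have hγ0 : 0 < γ := by positivity
  have hγ1 : γ ≤ 1 := by
    rw [hγ, div_le_one hβ0]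
    exact hβ1
  obtain ⟨A, hA⟩ : ∃ A : ℕ, ((d : ℝ) + d * β) / γ < A := exists_nat_gt _
  rw [div_lt_iff₀ hγ0] at hA
  choose u hu using fun c => denseRange_ofPoly.exists_dist_lt (x c) (half_pos hr)
  choose v hv using fun c => denseRange_ofPoly.exists_dist_lt (y c) (by positivity : 0 < δ / 4)
  obtain ⟨g, hg, hg0⟩ := ((eventually_all.2 fun c : Fin d =>
    eventually_exists_perturb hw hadm d A μ hβ0 hγ0 hγ1 hA (u c) (v c)
      (by positivity : 0 < min (r / 2) (δ / 4))).and (eventually_gt_atTop 0)).exists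
  have hpos : ∀ j : Fin g, (0 : ℝ) < γ + β * j / g := fun j => by positivity
  choose U hU1 hU2 using fun c : Fin d => hg c
    (fun j => ⟨γ + β * (finFunctionFinEquiv.symm j c : Fin g) / g, hpos _⟩)
    (fun j => le_add_of_nonneg_right (by positivity))
  refine ⟨fun c => ofPoly (U c), ?_, ?_⟩
  · rw [Metric.mem_ball, dist_pi_lt_iff hr]
    intro c
    have h1 := (hU1 c).trans_le (min_le_left _ _)
    have h2 := hu c
    rw [dist_comm] at h2
    rw [← dist_eq_norm] at h1
    linarith [dist_triangle (ofPoly (U c)) (ofPoly (u c)) (x c)]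
  · refine mem_interior_goodVectors hw hadm hβ0.le (fun l hl c => (hl c).2)
      (N := hitTime μ (g ^ d) (g ^ A) (g ^ d)) hδ fun l hl => ?_
    choose j hj using fun c => exists_grid_index hβ0 hγ0 (hl c).1 (hl c).2 hg0
    have key := fun c => hU2 c (finFunctionFinEquiv j) (l c) (hl c).2
      (by simpa only [Equiv.symm_apply_apply] using hj c)
    refine ⟨hitTime μ (g ^ d) (g ^ A) (finFunctionFinEquiv j), ?_, ?_, ?_, fun k hk => ?_⟩
    · exact natDegree_lt_hitTime (k := 0) _ (by positivity) (Nat.zero_le _)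
    · refine Nat.add_le_add_left (Nat.mul_le_mul_right _ ?_) _
      exact Nat.succ_le_succ (finFunctionFinEquiv j).2.le
    · rw [pi_norm_lt_iff (by positivity)]
      intro c
      rw [Pi.sub_apply, shiftProd_iterate_apply, Pi.pow_apply]
      have h1 := (key c).1.trans_le (min_le_right _ _)
      have h2 := hv c
      rw [dist_comm, dist_eq_norm] at h2
      refine (norm_sub_le_norm_sub_add_norm_sub _ (ofPoly (v c)) _).trans_lt ?_
      linarith
    · funext c
      rw [shiftProd_iterate_apply, Pi.pow_apply]
      exact (key c).2 k hk

/-- Only the leading term of a polynomial in `u` matters along the iterates provided by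
`goodVectors`. -/
theorem isHypercyclicVector_aeval {d : ℕ} (T : (Fin d → EllOne) →L[ℂ] (Fin d → EllOne))
    {u : Fin d → EllOne}
    (hu : ∀ (μ i j : ℕ), ∃ n, 1 ≤ n ∧
      ‖T^[n] (u ^ (μ + 1)) - TopologicalSpace.denseSeq (Fin d → EllOne) i‖ < 1 / ((j : ℝ) + 1) ∧
      ∀ k, 1 ≤ k → k ≤ μ → ‖T^[n] (u ^ k)‖ < 1 / ((j : ℝ) + 1))
    {P : ℂ[X]} (hP : P ≠ 0) (hP0 : P.coeff 0 = 0) : IsHypercyclicVector T (aeval u P) := by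
  obtain ⟨μ, hμ⟩ : ∃ μ, P.natDegree = μ + 1 := by
    refine Nat.exists_eq_succ_of_ne_zero fun h => hP ?_
    rw [eq_C_of_natDegree_eq_zero h, hP0, C_0]
  have hc : P.coeff (μ + 1) ≠ 0 := by
    rw [← hμ]
    exact leadingCoeff_ne_zero.2 hP
  set c := P.coeff (μ + 1) with hcdef
  set S := ∑ k ∈ Finset.range (μ + 2), ‖P.coeff k‖ with hS
  have hcS : ‖c‖ ≤ S := Finset.single_le_sum (f := fun k => ‖P.coeff k‖)
    (fun _ _ => norm_nonneg _) (Finset.mem_range.2 (by omega : μ + 1 < μ + 2))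
  have hS0 : 0 < S := (norm_pos_iff.2 hc).trans_le hcS
  rw [IsHypercyclicVector, Metric.dense_iff]
  intro y r hr
  obtain ⟨i, hi⟩ := (TopologicalSpace.denseRange_denseSeq (Fin d → EllOne)).exists_dist_lt
    (c⁻¹ • y) (by positivity : 0 < r / (2 * S))
  obtain ⟨j, hj⟩ := exists_nat_one_div_lt (by positivity : 0 < r / (2 * S))
  obtain ⟨n, hn, hy, hk⟩ := hu μ i j
  set z := TopologicalSpace.denseSeq (Fin d → EllOne) i
  refine ⟨T^[n] (aeval u P), ?_, n, hn, rfl⟩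
  rw [dist_eq_norm, norm_sub_rev] at hi
  have hcy : c • (z - c⁻¹ • y) = c • z - y := by
    rw [smul_sub, smul_smul, mul_inv_cancel₀ hc, one_smul]
  have hsum : T^[n] (aeval u P) - y = ∑ k ∈ Finset.range (μ + 2),
      P.coeff k • (if k = μ + 1 then T^[n] (u ^ k) - z else T^[n] (u ^ k)) + c • (z - c⁻¹ • y) := by
    rw [aeval_eq_sum_range, hμ, Finset.sum_range_succ, Finset.sum_range_succ _ (μ + 1), if_pos rfl,
      ← FunLike.coe_pow_eq_iterate, map_add, map_sum, map_smul, hcy, smul_sub]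
    have : ∀ k ∈ Finset.range (μ + 1), (T ^ n) (P.coeff k • u ^ k) =
        P.coeff k • if k = μ + 1 then (T ^ n) (u ^ k) - z else (T ^ n) (u ^ k) := by
      intro k hk
      rw [if_neg (Finset.mem_range.1 hk).ne, map_smul]
    rw [Finset.sum_congr rfl this]
    abel
  rw [Metric.mem_ball, dist_eq_norm, hsum]
  have h1 : ‖∑ k ∈ Finset.range (μ + 2),
      P.coeff k • (if k = μ + 1 then T^[n] (u ^ k) - z else T^[n] (u ^ k))‖ ≤
      S * (1 / ((j : ℝ) + 1)) := by
    rw [hS, Finset.sum_mul]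
    refine (norm_sum_le _ _).trans (Finset.sum_le_sum fun k hkr => ?_)
    rcases Nat.eq_zero_or_pos k with rfl | hk1
    · simp [hP0]
    · rw [norm_smul]
      refine mul_le_mul_of_nonneg_left ?_ (norm_nonneg _)
      split_ifs with h
      · rw [h]
        exact hy.le
      · exact (hk k hk1 (by have := Finset.mem_range.1 hkr; omega)).le
  have h2 : ‖c • (z - c⁻¹ • y)‖ ≤ S * (r / (2 * S)) := by
    rw [norm_smul]
    exact mul_le_mul hcS hi.le (norm_nonneg _) hS0.le
  have h3 : S * (1 / ((j : ℝ) + 1)) < S * (r / (2 * S)) := mul_lt_mul_of_pos_left hj hS0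
  have h4 : S * (r / (2 * S)) = r / 2 := by field_simp
  refine (norm_add_le _ _).trans_lt ?_
  linarith

theorem HasPolyGrowth.hasCommonHypercyclicAlgebra {w : Set.Ioi (0 : ℝ) → ℕ → ℝ}
    (hw : HasPolyGrowth w) (hadm : ∀ b, IsAdmissible (w b)) {d : ℕ} (hd : 1 ≤ d) :
    HasCommonHypercyclicAlgebra (fun l : Fin d → Set.Ioi (0 : ℝ) =>
      shiftProd (fun i => w (l i)) (fun i => hadm (l i))) := by
  have hdense := dense_iInter_of_isOpen (ι := ℕ × ℕ × ℕ × ℕ)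
    (fun _ => isOpen_interior) fun p => dense_interior_goodVectors hw hadm d p.1 p.2.1
      (TopologicalSpace.denseSeq (Fin d → EllOne) p.2.2.1) (Nat.one_div_pos_of_nat (n := p.2.2.2))
  obtain ⟨u, hu⟩ := hdense.nonempty
  rw [Set.mem_iInter] at hu
  have hyp : ∀ (l : Fin d → Set.Ioi (0 : ℝ)) (P : ℂ[X]), P ≠ 0 → P.coeff 0 = 0 →
      IsHypercyclicVector (shiftProd (fun i => w (l i)) (fun i => hadm (l i))) (aeval u P) := by
    intro l P hP hP0
    obtain ⟨q, hq⟩ : ∃ q : ℕ, ∀ c, 1 / ((q : ℝ) + 1) ≤ l c ∧ (l c : ℝ) ≤ q + 1 := by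
      have h : ∀ᶠ q : ℕ in atTop, ∀ c, 1 / ((q : ℝ) + 1) ≤ l c ∧ (l c : ℝ) ≤ q + 1 := by
        rw [eventually_all]
        intro c
        have h1 := (tendsto_one_div_add_atTop_nhds_zero_nat (𝕜 := ℝ)).eventually_lt_const
          (show (0 : ℝ) < l c from (l c).2)
        filter_upwards [h1, eventually_ge_atTop ⌈(l c : ℝ)⌉₊] with q h1 h2
        exact ⟨h1.le, (Nat.ceil_le.1 h2).trans (by linarith)⟩
      exact h.exists
    exact isHypercyclicVector_aeval _
      (fun μ i j => interior_subset (hu (q, μ, i, j)) l hq) hP hP0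
  refine ⟨polyAlgebra u, ?_, ?_⟩
  · intro hbot
    have hmem : u ∈ polyAlgebra u := ⟨X, coeff_X_zero, aeval_X u⟩
    rw [hbot, NonUnitalAlgebra.mem_bot] at hmem
    have h := hyp (fun _ => ⟨1, Set.mem_Ioi.2 one_pos⟩) X X_ne_zero coeff_X_zero
    rw [aeval_X, hmem] at h
    -- the orbit of `0` is `{0}`, which is not dense
    have h1 : (fun _ => ofPoly 1 : Fin d → EllOne) ∈ closure {(0 : Fin d → EllOne)} := by
      refine closure_mono ?_ (h _)
      rintro y ⟨n, -, rfl⟩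
      exact iterate_map_zero _ n
    rw [closure_singleton, Set.mem_singleton_iff] at h1
    have h2 := congrArg (fun x : EllOne => x 0) (congrFun h1 ⟨0, hd⟩)
    simp at h2
  · rintro _ ⟨P, hP0, rfl⟩ hx l
    refine hyp l P (fun h => hx ?_) hP0
    rw [h, map_zero]

theorem mainTheorem1 (d : ℕ) (hd : 1 ≤ d) (w : Set.Ioi (0 : ℝ) → ℕ → ℝ)
    (hw : (∀ a : Set.Ioi (0 : ℝ), ∀ n : ℕ, 1 ≤ n →
            ∏ k ∈ Finset.Icc 1 n, w a k = (n : ℝ) ^ (a : ℝ)) ∨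
          (∀ a : Set.Ioi (0 : ℝ), ∀ n : ℕ, 1 ≤ n → w a n = 1 + (a : ℝ) / (n : ℝ))) :
    ∃ hadm : ∀ a : Set.Ioi (0 : ℝ), IsAdmissible (w a),
      HasCommonHypercyclicAlgebra (fun l : Fin d → Set.Ioi (0 : ℝ) =>
        shiftProd (fun i => w (l i)) (fun i => hadm (l i))) := by
  have h : HasPolyGrowth w := hw.elim hasPolyGrowth_of_prod_eq hasPolyGrowth_of_eq
  exact ⟨h.isAdmissible, h.hasCommonHypercyclicAlgebra h.isAdmissible hd⟩
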